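/- Let $\Bbbk$ be a field of characteristic zero, let $n=2k-1$ for a positive integer $k$, and let $a_1,\dots,a_n\in\Bbbk$. Let $\Bbbk[x_1,\dots,x_n]$ act on $\Bbbk[X_1,\dots,X_n]$ with $x_i$ acting as $\partial/\partial X_i$, and write $V(y_1,\dots,y_m)=\det\big(y_i^{\,j-1}\big)_{1\le i,j\le m}=\prod_{1\le i<j\le m}(y_j-y_i)$ for the Vandermonde determinant, equal to $1$ when $m\le 1$. Let $F$ be the determinant of the $n\times n$ matrix whose $i$-th row, for $i=1,\dots,n$, is \[ \big(X_i,\; a_iX_i,\; a_i^2X_i,\;\dots,\; a_i^{k-1}X_i,\; a_i,\; a_i^2,\;\dots,\; a_i^{k-1}\big). \] Then \[ F=\frac{1}{k!\,(k-1)!}\sum_{\sigma\in\mathfrak S_n}\operatorname{sgn}(\sigma)\,V(a_{\sigma_1},\dots,a_{\sigma_k})\,V(a_{\sigma_{k+1}},\dots,a_{\sigma_n})\prod_{j=k+1}^{n}a_{\sigma_j}\prod_{j=1}^{k}X_{\sigma_j}. \] Moreover, $F$ is homogeneous of degree $k$ (or zero) and is annihilated by the squares of the $n+2$ linear forms $x_1,\dots,x_n$,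 $x_1+x_2+\dots+x_n$ and $a_1x_1+a_2x_2+\dots+a_nx_n$. If $a_1,\dots,a_n$ are non-zero and pairwise distinct (that is, if any $n$ of these $n+2$ linear forms are linearly independent), then $F\neq 0$, and $F$ is, up to a scalar factor, the unique form of degree $k$ in $\Bbbk[X_1,\dots,X_n]$ annihilated by these squares: every such form is a scalar multiple of $F$. -/

import Mathlib

open MvPolynomial

/-- The differential operator `∏ i, (∂/∂X_i) ^ (m i)` attached to the exponent vector `m`.
The partial derivatives commute, so the order of the factors does not matter. -/
noncomputable def diffMonomial (K : Type*) [Field K] (n : ℕ) (m : Fin n →₀ ℕ) :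
    Module.End K (MvPolynomial (Fin n) K) :=
  ((List.finRange n).map fun i =>
    ((pderiv i : Derivation K (MvPolynomial (Fin n) K) (MvPolynomial (Fin n) K)) :
      Module.End K (MvPolynomial (Fin n) K)) ^ m i).prod

/-- The apolarity action `f ∘ F` of a polynomial `f` in `x_1, …, x_n` on a polynomial `F` in
`X_1, …, X_n`, where `x_i` acts as `∂/∂X_i`. -/
noncomputable def apolarAction {K : Type*} [Field K] {n : ℕ} (f F : MvPolynomial (Fin n) K) :
    MvPolynomial (Fin n) K :=
  ∑ m ∈ f.support, f.coeff m • diffMonomial K n m F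

/-- The linear form `c_1 x_1 + ⋯ + c_n x_n`. -/
noncomputable def linForm {K : Type*} [Field K] {n : ℕ} (c : Fin n → K) :
    MvPolynomial (Fin n) K :=
  ∑ i, C (c i) * X i

/-- `F` is annihilated, under the apolarity action, by the squares of the `n + 2` linear forms
`x_1, …, x_n`, `x_1 + ⋯ + x_n` and `a_1 x_1 + ⋯ + a_n x_n`. -/
def AnnihilatedBySquares {K : Type*} [Field K] {n : ℕ} (a : Fin n → K)
    (F : MvPolynomial (Fin n) K) : Prop :=
  (∀ i, apolarAction (X i ^ 2) F = 0) ∧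
    apolarAction (linForm (fun _ => 1) ^ 2) F = 0 ∧
    apolarAction (linForm a ^ 2) F = 0

/-- The `n × n` matrix, `n = 2k - 1`, whose `i`-th row is
`X_i, a_i X_i, …, a_i^(k-1) X_i, a_i, a_i^2, …, a_i^(k-1)`. -/
noncomputable def blockMatrix {K : Type*} [Field K] (k : ℕ) (a : Fin (2 * k - 1) → K) :
    Matrix (Fin (2 * k - 1)) (Fin (2 * k - 1)) (MvPolynomial (Fin (2 * k - 1)) K) :=
  Matrix.of fun i j =>
    if (j : ℕ) < k then C (a i ^ (j : ℕ)) * X i else C (a i ^ ((j : ℕ) - k + 1))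

/-- The Vandermonde determinant `V(y_1, …, y_m) = ∏_{i < j} (y_j - y_i)`. -/
noncomputable def vandermondeDet {K : Type*} [Field K] {m : ℕ} (y : Fin m → K) : K :=
  (Matrix.vandermonde y).det

/-- The sum, over all permutations `σ` of the `n = 2k - 1` indices, of
`sgn(σ) V(a_σ(1), …, a_σ(k)) V(a_σ(k+1), …, a_σ(n)) ∏_{j=k+1}^n a_σ(j) ∏_{j=1}^k X_σ(j)`. -/
noncomputable def signedVandermondeSum {K : Type*} [Field K] (k : ℕ)
    (a : Fin (2 * k - 1) → K) : MvPolynomial (Fin (2 * k - 1)) K :=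
  ∑ σ : Equiv.Perm (Fin (2 * k - 1)),
    C (((Equiv.Perm.sign σ : ℤ) : K)
        * vandermondeDet (fun i : Fin k => a (σ ⟨i, by omega⟩))
        * vandermondeDet (fun i : Fin (k - 1) => a (σ ⟨k + i, by omega⟩))
        * ∏ i : Fin (k - 1), a (σ ⟨k + i, by omega⟩))
      * ∏ i : Fin k, X (σ ⟨i, by omega⟩)

/-! ### Weighted lowering and raising operators on set functions -/

section SetFunctions

variable {ι K : Type*} [DecidableEq ι] [Field K]

/-! Existence. Differentiating `F` along `∑ ∂/∂X_i` or `∑ a_i ∂/∂X_i` sends all but one of the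
columns `a^j X` to a column of pure powers already present. Hence only the exceptional column
contributes, and a second derivative kills it. Each `X_i` occurs only in row `i`, to first order, so
`x_i²` kills `F` as well. Substituting `X_i = a_i^k` turns `F` into `± ∏ a_i` times a Vandermonde
determinant, so `F ≠ 0`.

Uniqueness. A form killed by all `x_i²` is squarefree, hence a function `g` on `k`-subsets of `2k -
1` points, on which a linear form acts as a weighted lowering operator. With `m = k - 1`, an `sl₂`
argument turns `L_u² g = 0` into the first order relations `∑_{i ∈ Z} u_i⁻¹ g(Z \ i) = 0` for `|Z| =
m + 2`. On complements these are lowering relations again, with weights `u⁻¹`. The relations for `u`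
and `v` can be combined so that the weight at a chosen point vanishes. Eliminating two points `x`,
`y` then gives second order relations on the remaining `2m - 1` points, again for two weights in
general position. Induction shows that a single value determines `g`
(`exists_forall_eq_zero_of_lowering_lowering`).

The formula. The Leibniz terms of `F` are grouped by cosets of `S_k × S_{k-1}`. -/

/-- The weighted lowering operator on functions of subsets of `A`. It describes the action of
`∑ i, u i ∂/∂X_i` on the coefficients of a squarefree polynomial. -/
def lowering (A : Finset ι) (u : ι → K) (g : Finset ι → K) (T : Finset ι) : K :=
  ∑ i ∈ A \ T, u i * g (insert i T)

/-- The raising operator, adjoint to the unweighted lowering operator. -/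
def raising (g : Finset ι → K) (Z : Finset ι) : K :=
  ∑ i ∈ Z, g (Z.erase i)

theorem lowering_congr {A T : Finset ι} {g h : Finset ι → K} (u : ι → K) (hT : T ⊆ A)
    (H : ∀ S ⊆ A, S.card = T.card + 1 → g S = h S) : lowering A u g T = lowering A u h T := by
  refine Finset.sum_congr rfl fun i hi => ?_
  rw [Finset.mem_sdiff] at hi
  rw [H _ (Finset.insert_subset hi.1 hT) (Finset.card_insert_of_notMem hi.2)]

theorem raising_eq_zero {A Z : Finset ι} {g : Finset ι → K} (hZ : Z ⊆ A)
    (H : ∀ S ⊆ A, S.card + 1 = Z.card → g S = 0) : raising g Z = 0 :=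
  Finset.sum_eq_zero fun _ hi =>
    H _ ((Finset.erase_subset _ _).trans hZ) (Finset.card_erase_add_one hi)

/-- The `sl₂` commutation relation: the exchange terms `g(S - j + i)` cancel, and the diagonal terms
leave `|A \ S| - |S|`. -/
theorem lowering_raising {A S : Finset ι} (hS : S ⊆ A) (g : Finset ι → K) :
    lowering A 1 (raising g) S
      = raising (lowering A 1 g) S + ((A.card : K) - 2 * S.card) * g S := by
  have h1 : lowering A 1 (raising g) S
      = ∑ i ∈ A \ S, (g S + ∑ j ∈ S, g (insert i (S.erase j))) := by
    refine Finset.sum_congr rfl fun i hi => ?_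
    rw [Finset.mem_sdiff] at hi
    rw [Pi.one_apply, one_mul, raising, Finset.sum_insert hi.2, Finset.erase_insert hi.2]
    congr 1
    refine Finset.sum_congr rfl fun j hj => ?_
    rw [Finset.erase_insert_of_ne]
    rintro rfl
    exact hi.2 hj
  have h2 : raising (lowering A 1 g) S
      = ∑ j ∈ S, (g S + ∑ i ∈ A \ S, g (insert i (S.erase j))) := by
    refine Finset.sum_congr rfl fun j hj => ?_
    rw [lowering, Finset.sdiff_erase (hS hj), Finset.sum_insert (by simp [hj])]
    simp [Finset.insert_erase hj]
  rw [h1, h2, Finset.sum_add_distrib, Finset.sum_add_distrib, Finset.sum_comm,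
    Finset.sum_const, Finset.sum_const, Finset.card_sdiff_of_subset hS, nsmul_eq_mul, nsmul_eq_mul,
    Nat.cast_sub (Finset.card_le_card hS)]
  ring

/-- The string generated by a lowest weight vector of degree `d`; the scalar is the sum of `|A| -
2(d + r)` over `0 ≤ r ≤ m`. -/
theorem lowering_iterate_raising {A : Finset ι} {g : Finset ι → K} {d : ℕ}
    (hg : ∀ T ⊆ A, T.card + 1 = d → lowering A 1 g T = 0) (m : ℕ) :
    ∀ S ⊆ A, S.card = d + m → lowering A 1 (raising^[m + 1] g) S
      = ((m : K) + 1) * ((A.card : K) - 2 * d - m) * (raising^[m] g) S := by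
  induction m with
  | zero =>
    intro S hS hd
    rw [Function.iterate_succ_apply', Function.iterate_zero, id, lowering_raising hS,
      raising_eq_zero hS fun T hT hc => hg T hT (by omega), hd]
    push_cast
    ring
  | succ m ih =>
    intro S hS hd
    rw [Function.iterate_succ_apply', lowering_raising hS]
    have h : raising (lowering A 1 (raising^[m + 1] g)) S
        = ((m : K) + 1) * ((A.card : K) - 2 * d - m) * (raising^[m + 1] g) S := by
      rw [Function.iterate_succ_apply' raising m, raising, raising, Finset.mul_sum]
      refine Finset.sum_congr rfl fun i hi => ?_
      rw [← Function.iterate_succ_apply' raising m]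
      refine ih _ ((Finset.erase_subset _ _).trans hS) ?_
      have := Finset.card_erase_add_one hi
      omega
    rw [h, hd]
    push_cast
    ring

/-- The lowering operator is injective above the middle degree. -/
theorem eq_zero_of_lowering_eq_zero [CharZero K] {A : Finset ι} {g : Finset ι → K} {d : ℕ}
    (hd : A.card < 2 * d) (hg : ∀ T ⊆ A, T.card + 1 = d → lowering A 1 g T = 0) :
    ∀ S ⊆ A, S.card = d → g S = 0 := by
  -- Downward induction on the degree `d + m`: beyond `|A|` there are no subsets, and below that the
  -- scalar relating the two ends never vanishes because `|A| < 2d`.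
  suffices H : ∀ j m, A.card + 1 ≤ d + m + j → ∀ S ⊆ A, S.card = d + m →
      (raising^[m] g) S = 0 by
    intro S hS hc
    simpa using H (A.card + 1) 0 (by omega) S hS hc
  intro j
  induction j with
  | zero =>
    intro m hm S hS hc
    have := Finset.card_le_card hS
    omega
  | succ j ih =>
    intro m hm S hS hc
    have h := lowering_iterate_raising hg m S hS hc
    have h0 : lowering A 1 (raising^[m + 1] g) S = 0 := by
      refine Finset.sum_eq_zero fun i hi => ?_
      rw [Finset.mem_sdiff] at hi
      rw [ih (m + 1) (by omega) _ (Finset.insert_subset hi.1 hS)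
        (by rw [Finset.card_insert_of_notMem hi.2]; omega), mul_zero]
    rw [h0] at h
    have e1 : (m : K) + 1 ≠ 0 := Nat.cast_add_one_ne_zero m
    have e2 : (A.card : K) - 2 * d - m ≠ 0 := by
      intro h
      have h' : (A.card : K) = ((2 * d + m : ℕ) : K) := by push_cast; linear_combination h
      have := Nat.cast_injective h'
      omega
    exact (mul_eq_zero.mp h.symm).resolve_left (mul_ne_zero e1 e2)

/-- In degree `m + 1` on `2 m + 1` points, the kernel of the square of the lowering operator is
contained in the kernel of the raising operator. -/
theorem raising_eq_zero_of_lowering_lowering [CharZero K] {A : Finset ι} {g : Finset ι → K} {m : ℕ}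
    (hA : A.card = 2 * m + 1)
    (hg : ∀ T ⊆ A, T.card + 1 = m → lowering A 1 (lowering A 1 g) T = 0) :
    ∀ Z ⊆ A, Z.card = m + 2 → raising g Z = 0 := by
  -- Writing `L`, `R` for lowering and raising, `L² R g = R L² g = 0`, since the scalars `-1` and
  -- `+1` in degrees `m + 1` and `m` cancel. Degrees `m + 2` and `m + 1` both lie above the middle,
  -- so `L` can be cancelled twice.
  refine eq_zero_of_lowering_eq_zero (by omega) fun S hS hc => ?_
  refine eq_zero_of_lowering_eq_zero (g := lowering A 1 (raising g)) (d := m + 1) (by omega)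
    (fun T hT hc => ?_) S hS (by omega)
  have h1 : lowering A 1 (lowering A 1 (raising g)) T
      = lowering A 1 (fun S => raising (lowering A 1 g) S - g S) T := by
    refine lowering_congr 1 hT fun S hS hc' => ?_
    rw [lowering_raising hS, hA, show S.card = m + 1 by omega]
    push_cast
    ring
  have h2 : lowering A 1 (fun S => raising (lowering A 1 g) S - g S) T
      = lowering A 1 (raising (lowering A 1 g)) T - lowering A 1 g T := by
    simp only [lowering, mul_sub, Finset.sum_sub_distrib]
  rw [h1, h2, lowering_raising hT, raising_eq_zero hT fun R hR hc' => hg R hR (by omega), hA,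
    show T.card = m by omega]
  push_cast
  ring

/-- Multiplying `g S` by `∏ i ∈ S, u i` conjugates the weighted operator to the unweighted one;
dividing by the product over `Z` leaves the inverse weights. -/
theorem sum_inv_mul_erase_eq_zero [CharZero K] {A : Finset ι} {g : Finset ι → K} {m : ℕ} {u : ι → K}
    (hA : A.card = 2 * m + 1) (hu : ∀ i ∈ A, u i ≠ 0)
    (hg : ∀ T ⊆ A, T.card + 1 = m → lowering A u (lowering A u g) T = 0) {Z : Finset ι}
    (hZ : Z ⊆ A) (hc : Z.card = m + 2) : ∑ i ∈ Z, (u i)⁻¹ * g (Z.erase i) = 0 := by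
  have key : ∀ f : Finset ι → K, ∀ T, lowering A 1 (fun S => (∏ i ∈ S, u i) * f S) T
      = (∏ i ∈ T, u i) * lowering A u f T := by
    intro f T
    rw [lowering, lowering, Finset.mul_sum]
    refine Finset.sum_congr rfl fun i hi => ?_
    rw [Finset.mem_sdiff] at hi
    rw [Finset.prod_insert hi.2, Pi.one_apply]
    ring
  have h := raising_eq_zero_of_lowering_lowering (g := fun S => (∏ i ∈ S, u i) * g S) hA
    (fun T hT hc => by
      rw [show lowering A 1 (fun S => (∏ i ∈ S, u i) * g S)
        = fun S => (∏ i ∈ S, u i) * lowering A u g S from funext (key g), key, hg T hT hc,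
        mul_zero]) Z hZ hc
  have hne : ∏ i ∈ Z, u i ≠ 0 := Finset.prod_ne_zero_iff.mpr fun i hi => hu i (hZ hi)
  refine (mul_eq_zero.mp (Eq.trans ?_ h)).resolve_left hne
  rw [raising, Finset.mul_sum]
  refine Finset.sum_congr rfl fun i hi => ?_
  rw [← Finset.mul_prod_erase Z u hi]
  field_simp [hu i (hZ hi)]

theorem lowering_insert_insert {B W : Finset ι} {x y : ι} (hxy : x ≠ y) (hx : x ∉ B) (hy : y ∉ B)
    (hW : W ⊆ B) {w : ι → K} (hw : w x = 0) (h : Finset ι → K) :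
    lowering (insert x (insert y B)) w h W = w y * h (insert y W) + lowering B w h W := by
  have e : insert x (insert y B) \ W = insert x (insert y (B \ W)) := by
    rw [Finset.insert_sdiff_of_notMem _ fun h => hx (hW h),
      Finset.insert_sdiff_of_notMem _ fun h => hy (hW h)]
  rw [lowering, e, Finset.sum_insert (by simp [hxy, hx]), Finset.sum_insert (by simp [hy]), hw,
    zero_mul, zero_add, lowering]

theorem lowering_insert_insert_insert {B V : Finset ι} {x y : ι} (hxy : x ≠ y) (hx : x ∉ B)
    (hy : y ∉ B) (hV : V ⊆ B) (w : ι → K) (h : Finset ι → K) :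
    lowering (insert x (insert y B)) w h (insert y V)
      = w x * h (insert x (insert y V)) + ∑ i ∈ B \ V, w i * h (insert i (insert y V)) := by
  have e : insert x (insert y B) \ insert y V = insert x (B \ V) := by
    ext i
    simp only [Finset.mem_sdiff, Finset.mem_insert]
    have : x ∉ V := fun h => hx (hV h)
    grind
  rw [lowering, e, Finset.sum_insert (by simp [hx])]

/-- Eliminating two points turns a first order condition into a second order one. -/
theorem lowering_lowering_eq_zero {B : Finset ι} {x y : ι} (hxy : x ≠ y) (hx : x ∉ B) (hy : y ∉ B)
    {w : ι → K} (hw : w x = 0) {h : Finset ι → K} {m : ℕ}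
    (H : ∀ W ⊆ insert x (insert y B), W.card = m → lowering (insert x (insert y B)) w h W = 0)
    {V : Finset ι} (hV : V ⊆ B) (hc : V.card + 1 = m) : lowering B w (lowering B w h) V = 0 := by
  have h1 : lowering B w (lowering B w h) V
      = lowering B w (fun W => -(w y * h (insert y W))) V := by
    refine lowering_congr w hV fun W hW hc' => ?_
    have := H W (hW.trans fun i hi => by simp [hi]) (by omega)
    rw [lowering_insert_insert hxy hx hy hW hw] at this
    linear_combination this
  -- On sets containing `y` the term at `x` has weight zero, so this relation kills what remains
  -- after substituting `h1`.
  have h2 := H (insert y V) ((Finset.insert_subset_insert y hV).trans (Finset.subset_insert _ _))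
    (by rw [Finset.card_insert_of_notMem fun h => hy (hV h)]; exact hc)
  rw [lowering_insert_insert_insert hxy hx hy hV, hw, zero_mul, zero_add] at h2
  have h3 : lowering B w (fun W => -(w y * h (insert y W))) V
      = -w y * ∑ i ∈ B \ V, w i * h (insert i (insert y V)) := by
    rw [lowering, Finset.mul_sum]
    refine Finset.sum_congr rfl fun i _ => ?_
    rw [Finset.insert_comm]
    ring
  rw [h1, h3, h2, mul_zero]

/-- Recovers the eliminated values: once `h` vanishes inside `B`, only the term at `y` survives in
the relation. -/
theorem apply_insert_eq_zero {B : Finset ι} {x y : ι} (hxy : x ≠ y) (hx : x ∉ B) (hy : y ∉ B)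
    {w : ι → K} (hw : w x = 0) (hwy : w y ≠ 0) {h : Finset ι → K} {m : ℕ}
    (H : ∀ W ⊆ insert x (insert y B), W.card = m → lowering (insert x (insert y B)) w h W = 0)
    (h0 : ∀ S ⊆ B, S.card = m + 1 → h S = 0)
    {W : Finset ι} (hW : W ⊆ B) (hc : W.card = m) : h (insert y W) = 0 := by
  have h1 := H W (hW.trans fun i hi => by simp [hi]) hc
  rw [lowering_insert_insert hxy hx hy hW hw] at h1
  have h2 : lowering B w h W = 0 := by
    refine Finset.sum_eq_zero fun i hi => ?_
    rw [Finset.mem_sdiff] at hi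
    rw [h0 _ (Finset.insert_subset hi.1 hW) (by rw [Finset.card_insert_of_notMem hi.2, hc]),
      mul_zero]
  rw [h2, add_zero] at h1
  exact (mul_eq_zero.mp h1).resolve_left hwy

/-- A function on the `(m + 1)`-subsets of a set with `2 m + 1` elements which is killed by the
squares of two lowering operators in general position is determined by one of its values. -/
theorem exists_forall_eq_zero_of_lowering_lowering [CharZero K] (m : ℕ) :
    ∀ (A : Finset ι) (u v : ι → K), A.card = 2 * m + 1 → (∀ i ∈ A, u i ≠ 0) → (∀ i ∈ A, v i ≠ 0) →
      (∀ i ∈ A, ∀ j ∈ A, i ≠ j → u i * v j ≠ u j * v i) →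
      ∃ S₀ ⊆ A, S₀.card = m + 1 ∧ ∀ g : Finset ι → K,
        (∀ T ⊆ A, T.card + 1 = m → lowering A u (lowering A u g) T = 0) →
        (∀ T ⊆ A, T.card + 1 = m → lowering A v (lowering A v g) T = 0) →
        g S₀ = 0 → ∀ S ⊆ A, S.card = m + 1 → g S = 0 := by
  induction m with
  | zero =>
    intro A u v hA _ _ _
    refine ⟨A, subset_rfl, hA, fun g _ _ h S hS hc => ?_⟩
    rwa [Finset.eq_of_subset_of_card_le hS (by omega)]
  | succ m ih =>
    intro A u v hA hu hv huv
    obtain ⟨x, hxA, y, hyA, hxy⟩ := Finset.one_lt_card.mp (show 1 < A.card by omega)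
    obtain ⟨B, hxB, hyB, rfl⟩ : ∃ B : Finset ι, x ∉ B ∧ y ∉ B ∧ A = insert x (insert y B) := by
      refine ⟨(A.erase x).erase y, by simp, by simp, ?_⟩
      rw [Finset.insert_erase (by simp [hyA, hxy.symm]), Finset.insert_erase hxA]
    have hBA : B ⊆ insert x (insert y B) := fun i hi => by simp [hi]
    have hB : B.card = 2 * m + 1 := by
      rw [Finset.card_insert_of_notMem (by simp [hxy, hxB]), Finset.card_insert_of_notMem hyB] at hA
      omega
    have hne : ∀ i ∈ insert x (insert y B), ∀ j ∈ insert x (insert y B), i ≠ j →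
        (u i)⁻¹ * (v j)⁻¹ - (v i)⁻¹ * (u j)⁻¹ ≠ 0 := by
      intro i hi j hj hij h
      refine huv i hi j hj hij ?_
      have e1 := hu i hi
      have e2 := hu j hj
      have e3 := hv i hi
      have e4 := hv j hj
      field_simp at h
      linear_combination -h
    set A := insert x (insert y B) with hAdef
    -- The combination of the weights `u⁻¹` and `v⁻¹` that vanishes at the point `a`.
    let w : ι → ι → K := fun a i => (u i)⁻¹ * (v a)⁻¹ - (v i)⁻¹ * (u a)⁻¹
    have hww : ∀ a, w a a = 0 := fun a => by simp only [w]; ring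
    obtain ⟨S₀, hS₀, hc₀, key⟩ := ih B (w x) (w y) hB
      (fun i hi => hne i (hBA hi) x hxA fun h => hxB (h ▸ hi))
      (fun i hi => hne i (hBA hi) y hyA fun h => hyB (h ▸ hi))
      (fun i hi j hj hij h => by
        -- A `2 × 2` minor of the weights `w x`, `w y` is, up to sign, the product of two minors of
        -- `u⁻¹`, `v⁻¹`, so general position is inherited.
        have h1 : ((u i)⁻¹ * (v j)⁻¹ - (v i)⁻¹ * (u j)⁻¹)
            * ((u x)⁻¹ * (v y)⁻¹ - (v x)⁻¹ * (u y)⁻¹) = 0 := by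
          simp only [w] at h
          linear_combination h
        exact (mul_ne_zero (hne i (hBA hi) j (hBA hj) hij) (hne x hxA y hyA hxy)) h1)
    refine ⟨A \ S₀, Finset.sdiff_subset, ?_, fun g hgu hgv hg0 => ?_⟩
    · rw [Finset.card_sdiff_of_subset (hS₀.trans hBA)]
      omega
    -- Passing to complements turns erasing from `A \ W` into inserting into `W`, hence raising
    -- relations into lowering ones.
    let h : Finset ι → K := fun R => g (A \ R)
    have hinv : ∀ t : ι → K, (∀ i ∈ A, t i ≠ 0) →
        (∀ T ⊆ A, T.card + 1 = m + 1 → lowering A t (lowering A t g) T = 0) →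
        ∀ W ⊆ A, W.card = m → ∑ i ∈ A \ W, (t i)⁻¹ * h (insert i W) = 0 := by
      intro t ht hgt W hW hc
      have := sum_inv_mul_erase_eq_zero hA ht hgt (Finset.sdiff_subset (s := A) (t := W))
        (by rw [Finset.card_sdiff_of_subset hW]; omega)
      rw [← this]
      refine Finset.sum_congr rfl fun i _ => ?_
      simp only [h]
      rw [Finset.sdiff_insert]
    have hw : ∀ a, ∀ W ⊆ A, W.card = m → lowering A (w a) h W = 0 := by
      intro a W hW hc
      have h1 := hinv u hu hgu W hW hc
      have h2 := hinv v hv hgv W hW hc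
      have h3 : lowering A (w a) h W = (v a)⁻¹ * ∑ i ∈ A \ W, (u i)⁻¹ * h (insert i W)
          - (u a)⁻¹ * ∑ i ∈ A \ W, (v i)⁻¹ * h (insert i W) := by
        rw [lowering, Finset.mul_sum, Finset.mul_sum, ← Finset.sum_sub_distrib]
        refine Finset.sum_congr rfl fun i _ => ?_
        simp only [w]
        ring
      rw [h3, h1, h2, mul_zero, mul_zero, sub_zero]
    have hA' : A = insert y (insert x B) := Finset.insert_comm x y B
    have hwx := hw x
    have hwy := hw y
    have hwy' := hw y
    rw [hAdef] at hwx hwy'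
    rw [hA'] at hwy
    have hB0 : ∀ S ⊆ B, S.card = m + 1 → h S = 0 :=
      key h (fun T hT hc => lowering_lowering_eq_zero hxy hxB hyB (hww x) hwx hT hc)
        (fun T hT hc => lowering_lowering_eq_zero hxy.symm hyB hxB (hww y) hwy hT hc)
        (by simpa only [h] using hg0)
    have hy0 : ∀ W ⊆ B, W.card = m → h (insert y W) = 0 := fun W hW hc =>
      apply_insert_eq_zero hxy hxB hyB (hww x) (hne y hyA x hxA hxy.symm) hwx hB0 hW hc
    have hx0 : ∀ W ⊆ B, W.card = m → h (insert x W) = 0 := fun W hW hc =>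
      apply_insert_eq_zero hxy.symm hyB hxB (hww y) (hne x hxA y hyA hxy) hwy hB0 hW hc
    have hxy0 : ∀ V ⊆ B, V.card + 1 = m → h (insert x (insert y V)) = 0 := by
      intro V hV hc
      have h1 := hwy' (insert y V)
        ((Finset.insert_subset_insert y hV).trans (Finset.subset_insert _ _))
        (by rw [Finset.card_insert_of_notMem fun h => hyB (hV h)]; exact hc)
      rw [lowering_insert_insert_insert hxy hxB hyB hV, Finset.sum_eq_zero, add_zero] at h1
      · exact (mul_eq_zero.mp h1).resolve_left (hne x hxA y hyA hxy)
      · intro i hi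
        rw [Finset.mem_sdiff] at hi
        rw [Finset.insert_comm, hy0 _ (Finset.insert_subset hi.1 hV)
          (by rw [Finset.card_insert_of_notMem hi.2, hc]), mul_zero]
    have hall : ∀ R ⊆ A, R.card = m + 1 → h R = 0 := by
      intro R hR hc
      by_cases hxR : x ∈ R
      · obtain ⟨W, hxW, rfl⟩ : ∃ W, x ∉ W ∧ R = insert x W :=
          ⟨R.erase x, by simp, (Finset.insert_erase hxR).symm⟩
        rw [Finset.card_insert_of_notMem hxW] at hc
        by_cases hyW : y ∈ W
        · obtain ⟨V, hyV, rfl⟩ : ∃ V, y ∉ V ∧ W = insert y V :=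
            ⟨W.erase y, by simp, (Finset.insert_erase hyW).symm⟩
          rw [Finset.card_insert_of_notMem hyV] at hc
          refine hxy0 V (fun i hi => ?_) (by omega)
          have := hR (show i ∈ insert x (insert y V) by simp [hi])
          grind
        · refine hx0 W (fun i hi => ?_) (by omega)
          have := hR (show i ∈ insert x W by simp [hi])
          grind
      · by_cases hyR : y ∈ R
        · obtain ⟨W, hyW, rfl⟩ : ∃ W, y ∉ W ∧ R = insert y W :=
            ⟨R.erase y, by simp, (Finset.insert_erase hyR).symm⟩
          rw [Finset.card_insert_of_notMem hyW] at hc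
          refine hy0 W (fun i hi => ?_) (by omega)
          have := hR (show i ∈ insert y W by simp [hi])
          grind
        · refine hB0 R (fun i hi => ?_) hc
          have := hR hi
          grind
    intro S hS hc
    have := hall (A \ S) Finset.sdiff_subset (by rw [Finset.card_sdiff_of_subset hS]; omega)
    simpa only [h, Finset.sdiff_sdiff_eq_self hS] using this

end SetFunctions

/-! ### Derivatives of determinants -/

section DetDerivation

variable {K R ι : Type*} [CommRing K] [CommRing R] [Algebra K R] [DecidableEq ι]

theorem Derivation.map_finset_prod (D : Derivation K R R) (s : Finset ι) (f : ι → R) :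
    D (∏ i ∈ s, f i) = ∑ j ∈ s, ∏ i ∈ s, if i = j then D (f i) else f i := by
  induction s using Finset.induction_on with
  | empty => simp
  | insert a s ha ih =>
    rw [Finset.prod_insert ha, D.leibniz, ih, Finset.sum_insert ha, Finset.prod_insert ha,
      if_pos rfl, smul_eq_mul, smul_eq_mul, Finset.mul_sum, add_comm]
    congr 1
    · rw [mul_comm]
      congr 1
      refine Finset.prod_congr rfl fun i hi => ?_
      rw [if_neg]
      rintro rfl
      exact ha hi
    · refine Finset.sum_congr rfl fun j hj => ?_
      rw [Finset.prod_insert ha, if_neg]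
      rintro rfl
      exact ha hj

theorem Derivation.map_det_updateCol [Fintype ι] (D : Derivation K R R) (M : Matrix ι ι R) :
    D M.det = ∑ j, (M.updateCol j fun i => D (M i j)).det := by
  simp only [Matrix.det_apply, map_sum]
  rw [Finset.sum_comm]
  refine Finset.sum_congr rfl fun σ _ => ?_
  rw [← Finset.smul_sum, Units.smul_def, Units.smul_def, map_zsmul, D.map_finset_prod]
  congr 1
  refine Finset.sum_congr rfl fun j _ => Finset.prod_congr rfl fun i _ => ?_
  rw [Matrix.updateCol_apply]
  by_cases h : i = j
  · subst h; simp
  · simp [h]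

/-- If a derivation maps every column but one to zero or to another column, and its square kills
the remaining column, then its square kills the determinant. -/
theorem Derivation.map_map_det_eq_zero_of_col [Fintype ι] (D : Derivation K R R)
    {M : Matrix ι ι R} (j₀ : ι) (h₀ : ∀ i, D (D (M i j₀)) = 0)
    (h : ∀ j ≠ j₀, (∀ i, D (M i j) = 0) ∨ ∃ j' ≠ j, j' ≠ j₀ ∧ ∀ i, D (M i j) = M i j') :
    D (D M.det) = 0 := by
  -- Stated for `N` so as to cover both `M` and `M` with column `j₀` already differentiated.
  have aux : ∀ N : Matrix ι ι R, (∀ j ≠ j₀, ∀ i, N i j = M i j) → ∀ j ≠ j₀,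
      (N.updateCol j fun i => D (N i j)).det = 0 := by
    intro N hN j hj
    rcases h j hj with h | ⟨j', hj', hj₀, h⟩
    · refine Matrix.det_eq_zero_of_column_eq_zero j fun i => ?_
      rw [Matrix.updateCol_self, hN j hj, h]
    · refine Matrix.det_zero_of_column_eq hj' fun i => ?_
      rw [Matrix.updateCol_self, Matrix.updateCol_ne hj', hN j hj, hN j' hj₀, h]
  rw [D.map_det_updateCol, Finset.sum_eq_single j₀ (fun j _ => aux M (fun _ _ _ => rfl) j) (by simp),
    D.map_det_updateCol]
  refine Finset.sum_eq_zero fun j _ => ?_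
  by_cases hj : j = j₀
  · subst hj
    refine Matrix.det_eq_zero_of_column_eq_zero j fun i => ?_
    rw [Matrix.updateCol_self, Matrix.updateCol_self, h₀]
  · exact aux _ (fun j hj i => Matrix.updateCol_ne hj) j hj

/-- If a derivation kills all rows but one, and its square kills the remaining row, then its
square kills the determinant. -/
theorem Derivation.map_map_det_eq_zero_of_row [Fintype ι] (D : Derivation K R R)
    {M : Matrix ι ι R} (i₀ : ι) (h₀ : ∀ j, D (D (M i₀ j)) = 0)
    (h : ∀ i ≠ i₀, ∀ j, D (M i j) = 0) : D (D M.det) = 0 := by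
  rw [← Matrix.det_transpose]
  exact D.map_map_det_eq_zero_of_col i₀ h₀ fun i hi => Or.inl (h i hi)

end DetDerivation

/-! ### The apolarity action of squares of linear forms -/

section Apolar

variable {K : Type*} [Field K] {n : ℕ}

/-- The derivation `∑ i, c i ∂/∂X_i`. -/
noncomputable def linDeriv (c : Fin n → K) :
    Derivation K (MvPolynomial (Fin n) K) (MvPolynomial (Fin n) K) :=
  ∑ i, c i • pderiv i

theorem linDeriv_apply (c : Fin n → K) (F : MvPolynomial (Fin n) K) :
    linDeriv c F = ∑ i, c i • pderiv i F := by
  have h : ∀ s : Finset (Fin n), (∑ i ∈ s, c i • (pderiv i :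
      Derivation K (MvPolynomial (Fin n) K) (MvPolynomial (Fin n) K))) F
        = ∑ i ∈ s, c i • pderiv i F := by
    intro s
    induction s using Finset.induction_on with
    | empty => simp
    | insert i s hi ih =>
      rw [Finset.sum_insert hi, Finset.sum_insert hi, Derivation.add_apply, ih,
        Derivation.smul_apply]
  exact h _

theorem linDeriv_X (c : Fin n → K) (i : Fin n) : linDeriv c (X i) = C (c i) := by
  rw [linDeriv_apply, Finset.sum_eq_single i]
  · rw [pderiv_X_self, smul_eq_C_mul, mul_one]
  · intro j _ h
    rw [pderiv_X_of_ne h.symm, smul_zero]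
  · simp

theorem linDeriv_C (c : Fin n → K) (r : K) : linDeriv c (C r) = 0 := by
  rw [← algebraMap_eq]
  exact Derivation.map_algebraMap _ _

theorem pderiv_pderiv_comm (i j : Fin n) (F : MvPolynomial (Fin n) K) :
    pderiv i (pderiv j F) = pderiv j (pderiv i F) := by
  have h : ⁅(pderiv i : Derivation K (MvPolynomial (Fin n) K) (MvPolynomial (Fin n) K)),
      (pderiv j : Derivation K (MvPolynomial (Fin n) K) (MvPolynomial (Fin n) K))⁆ = 0 := by
    refine MvPolynomial.derivation_ext fun l => ?_
    rw [Derivation.commutator_apply]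
    simp only [pderiv_X, Pi.single_apply]
    split_ifs <;> simp
  have h' := Derivation.congr_fun h F
  rw [Derivation.commutator_apply] at h'
  exact sub_eq_zero.mp h'

/-- Needed because `diffMonomial` is a product in a noncommutative ring of endomorphisms. -/
theorem List.prod_map_pow_add_of_commute {α M : Type*} [Monoid M] {f : α → M}
    (hf : ∀ i j, Commute (f i) (f j)) (m m' : α → ℕ) (l : List α) :
    (l.map fun i => f i ^ (m i + m' i)).prod
      = (l.map fun i => f i ^ m i).prod * (l.map fun i => f i ^ m' i).prod := by
  induction l with
  | nil => simp
  | cons a l ih =>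
    have hc : Commute (f a ^ m' a) (l.map fun i => f i ^ m i).prod :=
      Commute.list_prod_right _ _ fun y hy => by
        obtain ⟨i, _, rfl⟩ := List.mem_map.mp hy
        exact (hf a i).pow_pow _ _
    simp only [List.map_cons, List.prod_cons]
    rw [ih, pow_add, mul_assoc, mul_assoc, ← mul_assoc (f a ^ m' a), hc.eq, mul_assoc]

theorem diffMonomial_add (m m' : Fin n →₀ ℕ) :
    diffMonomial K n (m + m') = diffMonomial K n m * diffMonomial K n m' := by
  simp only [diffMonomial]
  exact List.prod_map_pow_add_of_commute
    (fun i j => LinearMap.ext fun F => pderiv_pderiv_comm i j F) m m' _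

theorem diffMonomial_single (i : Fin n) (F : MvPolynomial (Fin n) K) :
    diffMonomial K n (Finsupp.single i 1) F = pderiv i F := by
  rw [diffMonomial, List.prod_map_eq_pow_single i]
  · rw [List.count_eq_one_of_mem (List.nodup_finRange n) (List.mem_finRange i)]
    simp
  · intro j hj _
    simp [Finsupp.single_eq_of_ne hj]

theorem apolarAction_eq_sum {s : Finset (Fin n →₀ ℕ)} {f : MvPolynomial (Fin n) K}
    (hs : f.support ⊆ s) (F : MvPolynomial (Fin n) K) :
    apolarAction f F = ∑ m ∈ s, f.coeff m • diffMonomial K n m F :=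
  Finset.sum_subset hs fun m _ hm => by rw [notMem_support_iff.mp hm, zero_smul]

theorem apolarAction_zero (F : MvPolynomial (Fin n) K) : apolarAction 0 F = 0 := by
  simp [apolarAction]

theorem apolarAction_add (f g F : MvPolynomial (Fin n) K) :
    apolarAction (f + g) F = apolarAction f F + apolarAction g F := by
  classical
  rw [apolarAction_eq_sum (s := f.support ∪ g.support) support_add,
    apolarAction_eq_sum (f := f) Finset.subset_union_left,
    apolarAction_eq_sum (f := g) Finset.subset_union_right, ← Finset.sum_add_distrib]
  simp only [coeff_add, add_smul]

theorem apolarAction_sum {α : Type*} (s : Finset α) (f : α → MvPolynomial (Fin n) K)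
    (F : MvPolynomial (Fin n) K) : apolarAction (∑ i ∈ s, f i) F = ∑ i ∈ s, apolarAction (f i) F := by
  classical
  induction s using Finset.induction_on with
  | empty => simp [apolarAction_zero]
  | insert a s ha ih => rw [Finset.sum_insert ha, Finset.sum_insert ha, apolarAction_add, ih]

theorem apolarAction_monomial (m : Fin n →₀ ℕ) (r : K) (F : MvPolynomial (Fin n) K) :
    apolarAction (monomial m r) F = r • diffMonomial K n m F := by
  rw [apolarAction_eq_sum (s := {m}) support_monomial_subset, Finset.sum_singleton, coeff_monomial,
    if_pos rfl]

theorem apolarAction_linForm_sq (c : Fin n → K) (F : MvPolynomial (Fin n) K) :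
    apolarAction (linForm c ^ 2) F = linDeriv c (linDeriv c F) := by
  have h : linForm c ^ 2
      = ∑ i, ∑ j, monomial (Finsupp.single i 1 + Finsupp.single j 1) (c i * c j) := by
    rw [linForm, sq, Finset.sum_mul_sum]
    refine Finset.sum_congr rfl fun i _ => Finset.sum_congr rfl fun j _ => ?_
    rw [← monomial_mul, C_mul_X_eq_monomial, C_mul_X_eq_monomial]
  rw [h, linDeriv_apply, apolarAction_sum]
  refine Finset.sum_congr rfl fun i _ => ?_
  rw [apolarAction_sum, linDeriv_apply, map_sum, Finset.smul_sum]
  refine Finset.sum_congr rfl fun j _ => ?_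
  rw [apolarAction_monomial, diffMonomial_add, Module.End.mul_apply, diffMonomial_single,
    diffMonomial_single, Derivation.map_smul, smul_smul]

theorem apolarAction_X_sq (i : Fin n) (F : MvPolynomial (Fin n) K) :
    apolarAction (X i ^ 2) F = pderiv i (pderiv i F) := by
  have h : (X i ^ 2 : MvPolynomial (Fin n) K)
      = monomial (Finsupp.single i 1 + Finsupp.single i 1) 1 := by
    rw [sq, X, monomial_mul, one_mul]
  rw [h, apolarAction_monomial, one_smul, diffMonomial_add, Module.End.mul_apply,
    diffMonomial_single, diffMonomial_single]

theorem annihilatedBySquares_iff {a : Fin n → K} {F : MvPolynomial (Fin n) K} :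
    AnnihilatedBySquares a F ↔ (∀ i, pderiv i (pderiv i F) = 0) ∧
      linDeriv (fun _ => 1) (linDeriv (fun _ => 1) F) = 0 ∧ linDeriv a (linDeriv a F) = 0 := by
  simp only [AnnihilatedBySquares, apolarAction_linForm_sq, apolarAction_X_sq]

end Apolar

/-! ### Coefficients of squarefree polynomials -/

section Squarefree

variable {K : Type*} [Field K] {n : ℕ}

/-- The coefficient of the squarefree monomial `∏ i ∈ S, X i`. -/
noncomputable def squarefreeCoeff (G : MvPolynomial (Fin n) K) (S : Finset (Fin n)) : K :=
  coeff (∑ i ∈ S, Finsupp.single i 1) G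

theorem sum_single_one_apply (S : Finset (Fin n)) (j : Fin n) :
    (∑ i ∈ S, Finsupp.single i 1 : Fin n →₀ ℕ) j = if j ∈ S then 1 else 0 := by
  simp [Finsupp.finsetSum_apply, Finsupp.single_apply]

theorem coeff_eq_zero_of_pderiv_pderiv [CharZero K] {G : MvPolynomial (Fin n) K} {i : Fin n}
    (hG : pderiv i (pderiv i G) = 0) {m : Fin n →₀ ℕ} (hm : 2 ≤ m i) : coeff m G = 0 := by
  obtain ⟨m', rfl⟩ : ∃ m', m = m' + Finsupp.single i 1 + Finsupp.single i 1 := by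
    refine ⟨m - Finsupp.single i 2, ?_⟩
    rw [add_assoc, ← Finsupp.single_add]
    exact (tsub_add_cancel_of_le (Finsupp.single_le_iff.mpr hm)).symm
  have h := congrArg (coeff m') hG
  rw [coeff_pderiv, coeff_pderiv, coeff_zero] at h
  have e1 : ((m' i : K) + 1) ≠ 0 := Nat.cast_add_one_ne_zero _
  have e2 : (((m' + Finsupp.single i 1 : Fin n →₀ ℕ) i : K) + 1) ≠ 0 := Nat.cast_add_one_ne_zero _
  exact (mul_eq_zero.mp ((mul_eq_zero.mp h).resolve_right e1)).resolve_right e2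

theorem pderiv_linDeriv_comm (c : Fin n → K) (i : Fin n) (F : MvPolynomial (Fin n) K) :
    pderiv i (linDeriv c F) = linDeriv c (pderiv i F) := by
  rw [linDeriv_apply, linDeriv_apply, map_sum]
  refine Finset.sum_congr rfl fun j _ => ?_
  rw [Derivation.map_smul, pderiv_pderiv_comm]

/-- For `i ∈ T` the derivative in `X i` would draw on a monomial with exponent `2` at `i`, whose
coefficient is zero. -/
theorem squarefreeCoeff_linDeriv [CharZero K] {G : MvPolynomial (Fin n) K}
    (hG : ∀ i, pderiv i (pderiv i G) = 0) (c : Fin n → K) :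
    squarefreeCoeff (linDeriv c G) = lowering Finset.univ c (squarefreeCoeff G) := by
  funext T
  rw [squarefreeCoeff, linDeriv_apply, coeff_sum, lowering]
  rw [← Finset.sum_subset (Finset.subset_univ (Finset.univ \ T)) fun i _ hi => ?_]
  swap
  · have hi : i ∈ T := by simpa using hi
    rw [coeff_smul, coeff_pderiv, coeff_eq_zero_of_pderiv_pderiv (hG i), zero_mul, smul_zero]
    rw [Finsupp.add_apply, sum_single_one_apply, if_pos hi, Finsupp.single_eq_same]
  · refine Finset.sum_congr rfl fun i hi => ?_
    have hi : i ∉ T := by simpa using hi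
    rw [coeff_smul, coeff_pderiv, sum_single_one_apply, if_neg hi, squarefreeCoeff,
      Finset.sum_insert hi, add_comm (Finsupp.single i 1)]
    simp

theorem lowering_lowering_squarefreeCoeff [CharZero K] {G : MvPolynomial (Fin n) K}
    (hG : ∀ i, pderiv i (pderiv i G) = 0) {c : Fin n → K} (hc : linDeriv c (linDeriv c G) = 0)
    (T : Finset (Fin n)) :
    lowering Finset.univ c (lowering Finset.univ c (squarefreeCoeff G)) T = 0 := by
  rw [← squarefreeCoeff_linDeriv hG, ← squarefreeCoeff_linDeriv, hc, squarefreeCoeff, coeff_zero]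
  intro i
  rw [pderiv_linDeriv_comm, pderiv_linDeriv_comm, hG, map_zero]

theorem eq_zero_of_squarefreeCoeff_eq_zero [CharZero K] {G : MvPolynomial (Fin n) K} {k : ℕ}
    (hk : G.IsHomogeneous k) (hG : ∀ i, pderiv i (pderiv i G) = 0)
    (h : ∀ S : Finset (Fin n), S.card = k → squarefreeCoeff G S = 0) : G = 0 := by
  ext m
  rw [coeff_zero]
  by_cases hm : ∃ i, 2 ≤ m i
  · obtain ⟨i, hi⟩ := hm
    exact coeff_eq_zero_of_pderiv_pderiv (hG i) hi
  push Not at hm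
  have e : m = ∑ i ∈ m.support, Finsupp.single i 1 := by
    ext j
    rw [sum_single_one_apply]
    have := hm j
    split_ifs with hj
    · have := Finsupp.mem_support_iff.mp hj
      omega
    · exact Finsupp.notMem_support_iff.mp hj
  have hd : m.degree = m.support.card := by
    rw [Finsupp.degree_apply, Finset.card_eq_sum_ones]
    refine Finset.sum_congr rfl fun i hi => ?_
    have := hm i
    have := Finsupp.mem_support_iff.mp hi
    omega
  by_cases hc : m.support.card = k
  · rw [e]
    exact h _ hc
  · exact hk.coeff_eq_zero (by rwa [hd])

/-- Forms of degree `k` in `2 k - 1` variables annihilated by the squares are determined by the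
coefficient of one squarefree monomial. -/
theorem exists_squarefreeCoeff_determines [CharZero K] {k : ℕ} (hk : 0 < k)
    {a : Fin (2 * k - 1) → K} (ha : Function.Injective a) (ha0 : ∀ i, a i ≠ 0) :
    ∃ S : Finset (Fin (2 * k - 1)), ∀ G : MvPolynomial (Fin (2 * k - 1)) K,
      G.IsHomogeneous k → AnnihilatedBySquares a G → squarefreeCoeff G S = 0 → G = 0 := by
  -- For the weights `1` and `a`, general position means that the `a i` are non-zero and distinct.
  obtain ⟨S, -, -, hS⟩ := exists_forall_eq_zero_of_lowering_lowering (k - 1)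
    (Finset.univ : Finset (Fin (2 * k - 1))) (fun _ => (1 : K)) a
    (by rw [Finset.card_univ, Fintype.card_fin]; omega) (fun _ _ => one_ne_zero)
    (fun i _ => ha0 i) (fun i _ j _ hij h => hij (ha (by simpa using h.symm)))
  refine ⟨S, fun G hG hsq h0 => ?_⟩
  obtain ⟨h1, h2, h3⟩ := annihilatedBySquares_iff.mp hsq
  exact eq_zero_of_squarefreeCoeff_eq_zero hG h1 fun T hT =>
    hS _ (fun T _ _ => lowering_lowering_squarefreeCoeff h1 h2 T)
      (fun T _ _ => lowering_lowering_squarefreeCoeff h1 h3 T) h0 T (Finset.subset_univ T) (by omega)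

end Squarefree

/-! ### The determinant -/

section BlockMatrix

variable {K : Type*} [Field K]

theorem blockMatrix_apply_of_lt {k : ℕ} (a : Fin (2 * k - 1) → K) (i : Fin (2 * k - 1))
    {j : Fin (2 * k - 1)} (hj : (j : ℕ) < k) : blockMatrix k a i j = C (a i ^ (j : ℕ)) * X i := by
  rw [blockMatrix, Matrix.of_apply, if_pos hj]

theorem blockMatrix_apply_of_le {k : ℕ} (a : Fin (2 * k - 1) → K) (i : Fin (2 * k - 1))
    {j : Fin (2 * k - 1)} (hj : k ≤ (j : ℕ)) :
    blockMatrix k a i j = C (a i ^ ((j : ℕ) - k + 1)) := by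
  rw [blockMatrix, Matrix.of_apply, if_neg (by omega)]

theorem linDeriv_blockMatrix_of_lt {k : ℕ} (a c : Fin (2 * k - 1) → K) (i : Fin (2 * k - 1))
    {j : Fin (2 * k - 1)} (hj : (j : ℕ) < k) :
    linDeriv c (blockMatrix k a i j) = C (a i ^ (j : ℕ) * c i) := by
  rw [blockMatrix_apply_of_lt a i hj, ← smul_eq_C_mul, Derivation.map_smul, linDeriv_X,
    smul_eq_C_mul, ← C_mul]

/-- The hypothesis says that every column `j < k` other than `j₀` differentiates to the pure power
column `k + l`, so that two columns coincide. -/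
theorem linDeriv_linDeriv_det_blockMatrix {k : ℕ} (a c : Fin (2 * k - 1) → K)
    {j₀ : Fin (2 * k - 1)} (hj₀ : (j₀ : ℕ) < k)
    (h : ∀ j : Fin (2 * k - 1), (j : ℕ) < k → j ≠ j₀ → ∃ l, l + 1 < k ∧
      ∀ i, a i ^ (j : ℕ) * c i = a i ^ (l + 1)) :
    linDeriv c (linDeriv c (blockMatrix k a).det) = 0 := by
  refine Derivation.map_map_det_eq_zero_of_col _ j₀ (fun i => ?_) fun j hj => ?_
  · rw [linDeriv_blockMatrix_of_lt a c i hj₀, linDeriv_C]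
  · rcases lt_or_ge (j : ℕ) k with hjk | hjk
    · obtain ⟨l, hl, hal⟩ := h j hjk hj
      refine Or.inr ⟨⟨k + l, by omega⟩, ?_, ?_, fun i => ?_⟩
      · intro h
        rw [← h] at hjk
        simp at hjk
      · intro h
        rw [← h] at hj₀
        simp at hj₀
      · rw [linDeriv_blockMatrix_of_lt a c i hjk, blockMatrix_apply_of_le a i (by simp), hal]
        simp
    · left
      intro i
      rw [blockMatrix_apply_of_le a i hjk, linDeriv_C]

theorem pderiv_pderiv_det_blockMatrix {k : ℕ} (a : Fin (2 * k - 1) → K) (i : Fin (2 * k - 1)) :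
    pderiv i (pderiv i (blockMatrix k a).det) = 0 := by
  refine Derivation.map_map_det_eq_zero_of_row _ i (fun j => ?_) fun r hr j => ?_
  · rcases lt_or_ge (j : ℕ) k with hjk | hjk
    · rw [blockMatrix_apply_of_lt a i hjk, pderiv_C_mul, pderiv_X_self, mul_one, pderiv_C]
    · rw [blockMatrix_apply_of_le a i hjk, pderiv_C, map_zero]
  · rcases lt_or_ge (j : ℕ) k with hjk | hjk
    · rw [blockMatrix_apply_of_lt a r hjk, pderiv_C_mul, pderiv_X_of_ne hr, mul_zero]
    · rw [blockMatrix_apply_of_le a r hjk, pderiv_C]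

theorem annihilatedBySquares_det_blockMatrix {k : ℕ} (hk : 0 < k) (a : Fin (2 * k - 1) → K) :
    AnnihilatedBySquares a (blockMatrix k a).det := by
  refine annihilatedBySquares_iff.mpr ⟨pderiv_pderiv_det_blockMatrix a, ?_, ?_⟩
  -- The exception is the column `X`, as the constant column `1` is absent from the matrix.
  · refine linDeriv_linDeriv_det_blockMatrix a _ (j₀ := ⟨0, by omega⟩) hk fun j hj hj0 => ?_
    have : (j : ℕ) ≠ 0 := fun h => hj0 (Fin.ext h)
    refine ⟨j - 1, by omega, fun i => ?_⟩
    rw [mul_one, Nat.sub_add_cancel (by omega)]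
  · have hk' : k - 1 < 2 * k - 1 := by omega
    -- Here the exception is `a^(k-1) X`, as the column `a^k` is absent.
    refine linDeriv_linDeriv_det_blockMatrix a _ (j₀ := ⟨k - 1, hk'⟩) (by simpa using hk)
      fun j hj hj0 => ?_
    have : (j : ℕ) ≠ k - 1 := fun h => hj0 (Fin.ext h)
    have hlt : (j : ℕ) + 1 < k := by omega
    exact ⟨j, hlt, fun i => (pow_succ _ _).symm⟩

theorem det_blockMatrix_ne_zero {k : ℕ} {a : Fin (2 * k - 1) → K} (ha : Function.Injective a)
    (ha0 : ∀ i, a i ≠ 0) : (blockMatrix k a).det ≠ 0 := by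
  intro h
  -- `p j + 1` is the exponent of `a i` in column `j` after setting `X i = a i ^ k`. The remainder
  -- only supplies the `Fin` bound and changes nothing.
  let p : Fin (2 * k - 1) → Fin (2 * k - 1) := fun j =>
    if (j : ℕ) < k then ⟨(k + j - 1) % (2 * k - 1), Nat.mod_lt _ j.pos⟩
    else ⟨j - k, by omega⟩
  have hp : ∀ j, (p j : ℕ) = if (j : ℕ) < k then k + j - 1 else j - k := by
    intro j
    simp only [p]
    split_ifs with hj
    · exact Nat.mod_eq_of_lt (by omega)
    · rfl
  have hinj : Function.Injective p := by
    intro i j hij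
    have := congrArg Fin.val hij
    rw [hp, hp] at this
    apply Fin.ext
    split_ifs at this <;> omega
  let e : Equiv.Perm (Fin (2 * k - 1)) := Equiv.ofBijective p (Finite.injective_iff_bijective.mp hinj)
  have hM : (eval fun i => a i ^ k).mapMatrix (blockMatrix k a)
      = Matrix.diagonal a * (Matrix.vandermonde a).submatrix id e := by
    ext i j
    rw [Matrix.diagonal_mul, Matrix.submatrix_apply, Matrix.vandermonde_apply, id,
      RingHom.mapMatrix_apply, Matrix.map_apply, ← pow_succ']
    change _ = a i ^ ((p j : ℕ) + 1)
    rw [hp]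
    rcases lt_or_ge (j : ℕ) k with hjk | hjk
    · rw [blockMatrix_apply_of_lt a i hjk, if_pos hjk, map_mul, eval_C, eval_X, ← pow_add]
      congr 1
      omega
    · rw [blockMatrix_apply_of_le a i hjk, if_neg (by omega), eval_C]
  have h1 := congrArg (eval fun i => a i ^ k) h
  rw [RingHom.map_det, hM, Matrix.det_mul, Matrix.det_diagonal, Matrix.det_permute', map_zero] at h1
  refine mul_ne_zero (Finset.prod_ne_zero_iff.mpr fun i _ => ha0 i) (mul_ne_zero ?_
    (Matrix.det_vandermonde_ne_zero_iff.mpr ha)) h1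
  rcases Int.units_eq_one_or (Equiv.Perm.sign e) with h | h <;> simp [h]

/-- The splitting of the `2 k - 1` indices into the first `k` and the last `k - 1`. -/
def splitIndex {k : ℕ} (hk : 0 < k) : Fin k ⊕ Fin (k - 1) ≃ Fin (2 * k - 1) :=
  finSumFinEquiv.trans (finCongr (by omega))

theorem det_blockMatrix_eq_sum {k : ℕ} (hk : 0 < k) (a : Fin (2 * k - 1) → K) :
    (blockMatrix k a).det = ∑ σ : Equiv.Perm (Fin (2 * k - 1)),
      C (((Equiv.Perm.sign σ : ℤ) : K)
          * ((∏ i : Fin k, a (σ (splitIndex hk (Sum.inl i))) ^ (i : ℕ))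
          * ∏ i : Fin (k - 1), a (σ (splitIndex hk (Sum.inr i))) ^ ((i : ℕ) + 1)))
        * ∏ i : Fin k, X (σ (splitIndex hk (Sum.inl i))) := by
  rw [Matrix.det_apply']
  refine Finset.sum_congr rfl fun σ _ => ?_
  rw [← (splitIndex hk).prod_comp, Fintype.prod_sum_type]
  have h1 : ∀ i : Fin k, blockMatrix k a (σ (splitIndex hk (Sum.inl i))) (splitIndex hk (Sum.inl i))
      = C (a (σ (splitIndex hk (Sum.inl i))) ^ (i : ℕ)) * X (σ (splitIndex hk (Sum.inl i))) :=
    fun i => blockMatrix_apply_of_lt a _ i.isLt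
  have h2 : ∀ i : Fin (k - 1),
      blockMatrix k a (σ (splitIndex hk (Sum.inr i))) (splitIndex hk (Sum.inr i))
        = C (a (σ (splitIndex hk (Sum.inr i))) ^ ((i : ℕ) + 1)) := by
    intro i
    rw [blockMatrix_apply_of_le a _ (by simp [splitIndex])]
    simp [splitIndex]
  simp only [h1, h2, Finset.prod_mul_distrib, C_mul, map_prod, map_intCast]
  ring

/-- The permutation of the `2 k - 1` indices that permutes the first `k` and the last `k - 1`
indices separately. -/
def splitPerm {k : ℕ} (hk : 0 < k) (τ : Equiv.Perm (Fin k)) (ρ : Equiv.Perm (Fin (k - 1))) :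
    Equiv.Perm (Fin (2 * k - 1)) :=
  (splitIndex hk).permCongr (Equiv.sumCongr τ ρ)

theorem splitPerm_inl {k : ℕ} (hk : 0 < k) (τ : Equiv.Perm (Fin k)) (ρ : Equiv.Perm (Fin (k - 1)))
    (i : Fin k) : splitPerm hk τ ρ (splitIndex hk (Sum.inl i)) = splitIndex hk (Sum.inl (τ i)) := by
  simp [splitPerm, Equiv.permCongr_apply]

theorem splitPerm_inr {k : ℕ} (hk : 0 < k) (τ : Equiv.Perm (Fin k)) (ρ : Equiv.Perm (Fin (k - 1)))
    (i : Fin (k - 1)) :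
    splitPerm hk τ ρ (splitIndex hk (Sum.inr i)) = splitIndex hk (Sum.inr (ρ i)) := by
  simp [splitPerm, Equiv.permCongr_apply]

theorem sign_splitPerm {k : ℕ} (hk : 0 < k) (τ : Equiv.Perm (Fin k))
    (ρ : Equiv.Perm (Fin (k - 1))) :
    Equiv.Perm.sign (splitPerm hk τ ρ) = Equiv.Perm.sign τ * Equiv.Perm.sign ρ := by
  rw [splitPerm, Equiv.Perm.sign_permCongr]
  exact Equiv.Perm.sign_sumCongr τ ρ

theorem vandermondeDet_eq_sum {m : ℕ} (y : Fin m → K) :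
    vandermondeDet y
      = ∑ τ : Equiv.Perm (Fin m), ((Equiv.Perm.sign τ : ℤ) : K) * ∏ i, y (τ i) ^ (i : ℕ) := by
  rw [vandermondeDet, Matrix.det_apply']
  rfl

theorem vandermondeDet_mul_prod_eq_sum {m : ℕ} (y : Fin m → K) :
    vandermondeDet y * ∏ i, y i = ∑ τ : Equiv.Perm (Fin m),
      ((Equiv.Perm.sign τ : ℤ) : K) * ∏ i, y (τ i) ^ ((i : ℕ) + 1) := by
  rw [vandermondeDet_eq_sum, Finset.sum_mul]
  refine Finset.sum_congr rfl fun τ _ => ?_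
  rw [← Equiv.prod_comp τ y, mul_assoc, ← Finset.prod_mul_distrib]
  simp only [pow_succ]

/-- Expanding both Vandermonde determinants yields Leibniz terms at `σ * splitPerm hk τ ρ`. For
fixed `τ`, `ρ`, right translation permutes the `σ`, so each of the `k! (k-1)!` sums over `σ` is the
determinant. -/
theorem signedVandermondeSum_eq {k : ℕ} (hk : 0 < k) (a : Fin (2 * k - 1) → K) :
    signedVandermondeSum k a
      = C ((k.factorial : K) * ((k - 1).factorial : K)) * (blockMatrix k a).det := by
  let t : Equiv.Perm (Fin (2 * k - 1)) → MvPolynomial (Fin (2 * k - 1)) K := fun σ =>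
      C (((Equiv.Perm.sign σ : ℤ) : K)
          * ((∏ i : Fin k, a (σ (splitIndex hk (Sum.inl i))) ^ (i : ℕ))
          * ∏ i : Fin (k - 1), a (σ (splitIndex hk (Sum.inr i))) ^ ((i : ℕ) + 1)))
        * ∏ i : Fin k, X (σ (splitIndex hk (Sum.inl i)))
  have hdet : (blockMatrix k a).det = ∑ σ, t σ := det_blockMatrix_eq_sum hk a
  have hsum : signedVandermondeSum k a
      = ∑ σ, ∑ τ : Equiv.Perm (Fin k), ∑ ρ : Equiv.Perm (Fin (k - 1)),
        t (σ * splitPerm hk τ ρ) := by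
    refine Finset.sum_congr rfl fun σ _ => ?_
    change C (((Equiv.Perm.sign σ : ℤ) : K)
        * vandermondeDet (fun i : Fin k => a (σ (splitIndex hk (Sum.inl i))))
        * vandermondeDet (fun i : Fin (k - 1) => a (σ (splitIndex hk (Sum.inr i))))
        * ∏ i : Fin (k - 1), a (σ (splitIndex hk (Sum.inr i))))
      * ∏ i : Fin k, X (σ (splitIndex hk (Sum.inl i))) = _
    rw [mul_assoc (_ * _), vandermondeDet_mul_prod_eq_sum, vandermondeDet_eq_sum, mul_assoc,
      Finset.sum_mul_sum, Finset.mul_sum, map_sum, Finset.sum_mul]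
    refine Finset.sum_congr rfl fun τ _ => ?_
    rw [Finset.mul_sum, map_sum, Finset.sum_mul]
    refine Finset.sum_congr rfl fun ρ _ => ?_
    simp only [t, Equiv.Perm.mul_apply, splitPerm_inl, splitPerm_inr, Equiv.Perm.sign_mul,
      sign_splitPerm, Units.val_mul, Int.cast_mul]
    rw [Equiv.prod_comp τ fun i =>
      (X (σ (splitIndex hk (Sum.inl i))) : MvPolynomial (Fin (2 * k - 1)) K)]
    congr 2
    ring
  have hshift : ∀ (τ : Equiv.Perm (Fin k)) (ρ : Equiv.Perm (Fin (k - 1))),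
      ∑ σ, t (σ * splitPerm hk τ ρ) = (blockMatrix k a).det := fun τ ρ =>
    (Equiv.sum_comp (Equiv.mulRight (splitPerm hk τ ρ)) t).trans hdet.symm
  rw [hsum, Finset.sum_comm]
  simp_rw [Finset.sum_comm (s := (Finset.univ : Finset (Equiv.Perm (Fin (2 * k - 1))))), hshift]
  simp only [Finset.sum_const, Finset.card_univ, Fintype.card_perm, Fintype.card_fin, nsmul_eq_mul,
    C_mul, map_natCast, mul_assoc]

theorem isHomogeneous_det_blockMatrix {k : ℕ} (hk : 0 < k) (a : Fin (2 * k - 1) → K) :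
    (blockMatrix k a).det.IsHomogeneous k := by
  rw [det_blockMatrix_eq_sum hk]
  refine IsHomogeneous.sum _ _ _ fun σ _ => IsHomogeneous.C_mul ?_ _
  simpa using IsHomogeneous.prod Finset.univ
    (fun i : Fin k => (X (σ (splitIndex hk (Sum.inl i))) : MvPolynomial (Fin (2 * k - 1)) K))
    (fun _ => 1) fun i _ => isHomogeneous_X _ _

end BlockMatrix

theorem AnnihilatedBySquares.sub_C_mul {K : Type*} [Field K] {n : ℕ} {a : Fin n → K}
    {G F : MvPolynomial (Fin n) K} (hG : AnnihilatedBySquares a G) (hF : AnnihilatedBySquares a F)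
    (c : K) : AnnihilatedBySquares a (G - C c * F) := by
  rw [annihilatedBySquares_iff] at *
  obtain ⟨g1, g2, g3⟩ := hG
  obtain ⟨f1, f2, f3⟩ := hF
  simp only [← smul_eq_C_mul, map_sub, Derivation.map_smul, g1, g2, g3, f1, f2, f3, smul_zero,
    sub_zero, implies_true, and_self]

theorem theorem5p1 {K : Type*} [Field K] [CharZero K] (k : ℕ) (hk : 0 < k)
    (a : Fin (2 * k - 1) → K) :
    (blockMatrix k a).det
        = C (((k.factorial : K) * ((k - 1).factorial : K))⁻¹) * signedVandermondeSum k a ∧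
    ((blockMatrix k a).det.IsHomogeneous k ∧ AnnihilatedBySquares a (blockMatrix k a).det) ∧
    (Function.Injective a → (∀ i, a i ≠ 0) →
      (blockMatrix k a).det ≠ 0 ∧
      ∀ G : MvPolynomial (Fin (2 * k - 1)) K,
        G.IsHomogeneous k → AnnihilatedBySquares a G →
          ∃ c : K, G = C c * (blockMatrix k a).det) := by
  have hF := isHomogeneous_det_blockMatrix hk a
  have hFa := annihilatedBySquares_det_blockMatrix hk a
  refine ⟨?_, ⟨hF, hFa⟩, fun ha ha0 => ⟨det_blockMatrix_ne_zero ha ha0, fun G hG hGa => ?_⟩⟩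
  · rw [signedVandermondeSum_eq hk, ← mul_assoc, ← C_mul, inv_mul_cancel₀, C_1, one_mul]
    exact mul_ne_zero (Nat.cast_ne_zero.mpr k.factorial_ne_zero)
      (Nat.cast_ne_zero.mpr (k - 1).factorial_ne_zero)
  · obtain ⟨S, hS⟩ := exists_squarefreeCoeff_determines hk ha ha0
    have hne : squarefreeCoeff (blockMatrix k a).det S ≠ 0 := fun h =>
      det_blockMatrix_ne_zero ha ha0 (hS _ hF hFa h)
    -- The scalar is chosen to cancel the determining coefficient of the difference.
    refine ⟨squarefreeCoeff G S / squarefreeCoeff (blockMatrix k a).det S,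
      sub_eq_zero.mp (hS _ (hG.sub (hF.C_mul _)) (hGa.sub_C_mul hFa _) ?_)⟩
    rw [squarefreeCoeff, coeff_sub, coeff_C_mul, ← squarefreeCoeff, ← squarefreeCoeff,
      div_mul_cancel₀ _ hne, sub_self]
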